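/- Let $m,n\ge 0$ and let $G\subseteq K_{m,n}$ be a connected bipartite graph with vertex set $U_1\sqcup U_2$, where $|U_1|=m$ and $|U_2|=n$. Write $e^i$ $(i\in U_1)$ and $f^j$ $(j\in U_2)$ for the standard basis of $\mathbb{Q}^{m+n}$, and put $(1,-1)=\sum_{i} e^i-\sum_{j} f^j$. Let $M_{\mathbb Q}=(1,-1)^{\perp}\subseteq\mathbb{Q}^{m+n}$ and $N_{\mathbb Q}=\mathbb{Q}^{m+n}/\mathbb{Q}\,(1,-1)$, with the pairing $M_{\mathbb Q}\times N_{\mathbb Q}\to\mathbb{Q}$ induced by the standard scalar product. Let $\sigma_G^{\vee}\subseteq M_{\mathbb Q}$ be the cone generated by the vectors $e^i+f^j$ for the edges $(i,j)$ of $G$, and let the edge cone be its dual, $\sigma_G=\{x\in N_{\mathbb Q} : \langle u,x\rangle\ge 0\text{ for all }u\in\sigma_G^{\vee}\}$. Let $\tau\preceq\sigma_G$ be a three-dimensional face that is not simplicial (that is, $\tau$ is not generated by linearly independent vectors). Then exactly four extremal rays of $\sigma_G$ are contained in $\tau$, and $\tau$ is spanned (as a cone) by these four extremal rays. -/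

import Mathlib

/-- The vector `(1, -1) = ∑ i, e i - ∑ j, f j` of `ℚ^(m+n)`. -/
def oneNegOne (m n : ℕ) : Fin m ⊕ Fin n → ℚ :=
  Sum.elim (fun _ => 1) (fun _ => -1)

/-- The vector space `M_ℚ`: the orthogonal complement of `(1, -1)` in `ℚ^(m+n)`. -/
def MQ (m n : ℕ) : Submodule ℚ (Fin m ⊕ Fin n → ℚ) :=
  LinearMap.ker (dotProductBilin ℚ ℚ (oneNegOne m n))

/-- The vector space `N_ℚ = ℚ^(m+n) / ⟨(1, -1)⟩`. -/
abbrev NQ (m n : ℕ) : Type :=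
  (Fin m ⊕ Fin n → ℚ) ⧸ Submodule.span ℚ {oneNegOne m n}

/-- The pairing `M_ℚ × N_ℚ → ℚ` induced by the standard scalar product of `ℚ^(m+n)`. -/
def pairingMN (m n : ℕ) : MQ m n →ₗ[ℚ] NQ m n →ₗ[ℚ] ℚ :=
  ((Submodule.span ℚ {oneNegOne m n}).liftQ
    ((dotProductBilin ℚ ℚ).compl₂ (MQ m n).subtype) (by
      rw [Submodule.span_singleton_le_iff_mem, LinearMap.mem_ker]
      ext u
      exact u.2)).flip

/-- The vector `e^i + f^j` of `M_ℚ`. -/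
def edgeVector (m n : ℕ) (i : Fin m) (j : Fin n) : MQ m n :=
  ⟨Pi.single (Sum.inl i) 1 + Pi.single (Sum.inr j) 1, by
    simp [MQ, oneNegOne, dotProductBilin]⟩

/-- The dual edge cone of a graph `G ⊆ K_{m,n}`: the cone in `M_ℚ` generated by the vectors
`e^i + f^j` for the edges `(i, j)` of `G`. -/
def dualEdgeCone {m n : ℕ} (G : SimpleGraph (Fin m ⊕ Fin n)) : PointedCone ℚ (MQ m n) :=
  PointedCone.hull ℚ
    {u | ∃ (i : Fin m) (j : Fin n), G.Adj (Sum.inl i) (Sum.inr j) ∧ u = edgeVector m n i j}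

/-- The edge cone of a graph `G ⊆ K_{m,n}`: the cone in `N_ℚ` dual to `dualEdgeCone G`. -/
def edgeCone {m n : ℕ} (G : SimpleGraph (Fin m ⊕ Fin n)) : PointedCone ℚ (NQ m n) :=
  PointedCone.dual (pairingMN m n) (dualEdgeCone G : Set (MQ m n))

/-- The dimension of a cone: the dimension of its linear span. -/
noncomputable def coneDim {V : Type*} [AddCommGroup V] [Module ℚ V] (τ : PointedCone ℚ V) : ℕ :=
  Module.finrank ℚ (Submodule.span ℚ (τ : Set V))

/-- `ρ` is an extremal ray of the cone `σ`: a face of `σ` which is a half-line. -/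
def IsExtremalRay {V : Type*} [AddCommGroup V] [Module ℚ V] (ρ σ : PointedCone ℚ V) : Prop :=
  ρ.IsFaceOf σ ∧ ∃ v : V, v ≠ 0 ∧ ρ = PointedCone.hull ℚ {v}

/-! Changing signs on $U_2$ turns $\sigma_G$ into the cone of functions on the vertices with $y_j\le
y_i$ for each edge $(i,j)$, modulo constants (`comap_ofPotential_edgeCone`). A face of such a cone
consists of the monotone functions that are constant on the classes of a partition. A generic
element of the face takes different values on distinct related classes, so the quotient relation is
acyclic and the classes can be numbered compatibly (`exists_labelling_of_face`).

Dimension three modulo constants means four classes, and connectedness of $G$ passes to the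
quotient. In terms of successive differences the face is a cone in $\mathbb{Q}^3$ whose irredundant
inequalities come from the covering relations of a connected poset on four elements. If these form a
tree, there are three independent inequalities and the cone is simplicial; otherwise they form a
4-cycle and the cone is the cone over a square (`isOrthantOrSquare_of_inequalities`), which has four
extremal rays. -/

/-! ### Faces of the cone of monotone functions. -/

/-- The cone of the functions that do not increase along a relation. -/
def monotoneCone {V : Type*} (E : V → V → Prop) : PointedCone ℚ (V → ℚ) where
  carrier := {y | ∀ u v, E u v → y v ≤ y u}
  zero_mem' := fun _ _ _ => le_rfl
  add_mem' := fun ha hb u v h => add_le_add (ha u v h) (hb u v h)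
  smul_mem' := fun c _ hy u v h => mul_le_mul_of_nonneg_left (hy u v h) c.2

theorem mem_monotoneCone {V : Type*} {E : V → V → Prop} {y : V → ℚ} :
    y ∈ monotoneCone E ↔ ∀ u v, E u v → y v ≤ y u := Iff.rfl

/-- A face of `monotoneCone E` has an element which is strictly monotone on every related pair that
some element of the face separates. -/
theorem exists_strict_mem_face {V : Type*} [Fintype V] {E : V → V → Prop}
    {F : PointedCone ℚ (V → ℚ)} (hF : F.IsFaceOf (monotoneCone E)) :
    ∃ z ∈ F, ∀ u v, E u v → (∃ y ∈ F, y u ≠ y v) → z v < z u := by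
  classical
  have hc : ∀ p : V × V, ∃ y ∈ F, E p.1 p.2 → (∃ y ∈ F, y p.1 ≠ y p.2) → y p.2 < y p.1 := by
    intro p
    by_cases h : E p.1 p.2 ∧ ∃ y ∈ F, y p.1 ≠ y p.2
    · obtain ⟨hE, y, hy, hne⟩ := h
      exact ⟨y, hy, fun _ _ => lt_of_le_of_ne (hF.le hy _ _ hE) hne.symm⟩
    · exact ⟨0, F.zero_mem, fun h1 h2 => absurd ⟨h1, h2⟩ h⟩
  choose y hyF hy using hc
  -- All summands are monotone, so one strict summand makes the sum strict.
  refine ⟨∑ p, y p, Submodule.sum_mem _ fun p _ => hyF p, fun u v hE hex => ?_⟩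
  simp only [Finset.sum_apply]
  exact Finset.sum_lt_sum (fun p _ => hF.le (hyF p) _ _ hE)
    ⟨(u, v), Finset.mem_univ _, hy (u, v) hE hex⟩

/-- Finitely many strict inequalities survive a small perturbation, and the tight ones are
unaffected because `y` is constant there. -/
theorem exists_sub_smul_mem_monotoneCone {V : Type*} [Finite V] {E : V → V → Prop} {z y : V → ℚ}
    (h : ∀ u v, E u v → z v < z u ∨ z v = z u ∧ y u = y v) :
    ∃ ε : ℚ, 0 < ε ∧ z - ε • y ∈ monotoneCone E := by
  have hev : ∀ᶠ ε : ℚ in nhdsWithin 0 (Set.Ioi 0), ∀ u v, E u v →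
      z v - ε * y v ≤ z u - ε * y u := by
    rw [Filter.eventually_all]; intro u
    rw [Filter.eventually_all]; intro v
    by_cases hE : E u v
    · simp only [hE, true_implies]
      rcases h u v hE with hlt | ⟨h1, h2⟩
      · have hcont : Filter.Tendsto (fun ε : ℚ => z u - ε * y u - (z v - ε * y v)) (nhds 0)
            (nhds (z u - z v)) := by
          have : Continuous (fun ε : ℚ => z u - ε * y u - (z v - ε * y v)) := by fun_prop
          simpa using this.tendsto 0
        have := (hcont.mono_left (nhdsWithin_le_nhds (s := Set.Ioi 0))).eventually
          (lt_mem_nhds (sub_pos.2 hlt))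
        filter_upwards [this] with ε hε
        linarith
      · simp [h1, h2]
    · simp [hE]
  obtain ⟨ε, h1, h2⟩ := (hev.and self_mem_nhdsWithin).exists
  exact ⟨ε, h2, h1⟩

/-- A face of `monotoneCone E` consists of the monotone functions on a quotient of the vertex set,
whose classes are numbered compatibly with the relation. -/
theorem exists_labelling_of_face {V : Type*} [Fintype V] {E : V → V → Prop}
    {F : PointedCone ℚ (V → ℚ)} (hF : F.IsFaceOf (monotoneCone E)) :
    ∃ (k : ℕ) (g : V → Fin k), Function.Surjective g ∧
      (∀ u v, E u v → g u ≠ g v → g v < g u) ∧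
      (∀ y, y ∈ F ↔ ∃ w : Fin k → ℚ, y = w ∘ g ∧ ∀ u v, E u v → w (g v) ≤ w (g u)) ∧
      Submodule.span ℚ (F : Set (V → ℚ)) = LinearMap.range (LinearMap.funLeft ℚ ℚ g) := by
  classical
  obtain ⟨z, hzF, hz⟩ := exists_strict_mem_face hF
  let s : Setoid V := ⟨fun u v => ∀ y ∈ F, y u = y v, fun _ _ _ => rfl,
    fun h y hy => (h y hy).symm, fun h h' y hy => (h y hy).trans (h' y hy)⟩
  let zq : Quotient s → ℚ := Quotient.lift z fun u v h => h z hzF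
  let e₀ := (Fintype.equivFin (Quotient s)).symm
  -- Classes are numbered by increasing value of `z`; ties are harmless, since distinct related
  -- classes have different values.
  let e := (Tuple.sort (zq ∘ e₀)).trans e₀
  have he : Monotone (zq ∘ e) := Tuple.monotone_sort (zq ∘ e₀)
  let g : V → Fin (Fintype.card (Quotient s)) := fun v => e.symm (Quotient.mk s v)
  have hg : ∀ u v, g u = g v ↔ ∀ y ∈ F, y u = y v := fun u v => by
    simp only [g, EmbeddingLike.apply_eq_iff_eq, Quotient.eq]; rfl
  have hgz : ∀ v, (zq ∘ e) (g v) = z v := fun v => by simp [g, zq]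
  have hsurj : Function.Surjective g := e.symm.surjective.comp Quotient.mk_surjective
  have hlt : ∀ u v, E u v → g u ≠ g v → z v < z u := fun u v hE hne => by
    refine hz u v hE ?_
    simpa [hg] using hne
  have hfac : ∀ w : Fin (Fintype.card (Quotient s)) → ℚ, ∀ u v, E u v →
      z v < z u ∨ z v = z u ∧ (w ∘ g) u = (w ∘ g) v := fun w u v hE => by
    by_cases h : g u = g v
    · exact Or.inr ⟨((hg u v).1 h z hzF).symm, by simp [h]⟩
    · exact Or.inl (hlt u v hE h)
  have hmem : ∀ y ∈ F, ∃ w : Fin (Fintype.card (Quotient s)) → ℚ, y = w ∘ g := fun y hy => by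
    refine ⟨y ∘ Function.surjInv hsurj, funext fun v => ?_⟩
    exact (hg _ _).1 (Function.surjInv_eq hsurj (g v)).symm y hy
  have hall : ∀ w : Fin (Fintype.card (Quotient s)) → ℚ, w ∘ g ∈ monotoneCone E → w ∘ g ∈ F := by
    intro w hw
    obtain ⟨ε, hε, hmemε⟩ := exists_sub_smul_mem_monotoneCone (hfac w)
    -- `z` is the sum of `ε • (w ∘ g)` and a monotone function, so the face contains `w ∘ g`.
    exact hF.mem_of_smul_add_mem hw hmemε hε (by simpa using hzF)
  refine ⟨_, g, hsurj, fun u v hE hne => ?_, fun y => ⟨fun hy => ?_, ?_⟩, le_antisymm ?_ ?_⟩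
  · by_contra hle
    have := he (not_lt.1 hle)
    rw [hgz, hgz] at this
    exact absurd (hlt u v hE hne) (not_lt.2 this)
  · obtain ⟨w, rfl⟩ := hmem y hy
    exact ⟨w, rfl, hF.le hy⟩
  · rintro ⟨w, rfl, hw⟩
    exact hall w hw
  · refine Submodule.span_le.2 fun y hy => ?_
    obtain ⟨w, rfl⟩ := hmem y hy
    exact ⟨w, rfl⟩
  -- Even if `w ∘ g` is not monotone, it is a multiple of the difference of `z` and `z - ε • (w ∘
  -- g)`, both in the face.
  · rintro _ ⟨w, rfl⟩
    obtain ⟨ε, hε, hmemε⟩ := exists_sub_smul_mem_monotoneCone (hfac w)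
    obtain ⟨w₀, hw₀⟩ := hmem z hzF
    have h1 : z - ε • (w ∘ g) ∈ F := by
      have : z - ε • (w ∘ g) = (w₀ - ε • w) ∘ g := by rw [hw₀]; rfl
      rw [this] at hmemε ⊢
      exact hall _ hmemε
    have h2 : (LinearMap.funLeft ℚ ℚ g) w = ε⁻¹ • (z - (z - ε • (w ∘ g))) := by
      rw [sub_sub_cancel, smul_smul, inv_mul_cancel₀ hε.ne', one_smul]; rfl
    rw [h2]
    exact Submodule.smul_mem _ _ (Submodule.sub_mem _ (Submodule.subset_span hzF)
      (Submodule.subset_span h1))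

/-! ### Extremal rays of finitely generated cones. -/

/-- A cone generated by finitely many vectors that span distinct faces of dimension one has exactly
these extremal rays. -/
theorem extremalRays_eq_range {N ι : Type*} [AddCommGroup N] [Module ℚ N] [Fintype ι]
    {τ : PointedCone ℚ N} {v : ι → N} (hτ : τ = PointedCone.hull ℚ (Set.range v))
    (hv : ∀ k, v k ≠ 0) (hface : ∀ k, (PointedCone.hull ℚ {v k}).IsFaceOf τ) :
    {ρ : PointedCone ℚ N | IsExtremalRay ρ τ} = Set.range fun k => PointedCone.hull ℚ {v k} := by
  ext ρ
  constructor
  · rintro ⟨hρ, w, hw, rfl⟩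
    have hwτ : w ∈ τ := hρ.le (Submodule.mem_span_singleton_self w)
    rw [hτ] at hwτ
    obtain ⟨c, hc⟩ := (Submodule.mem_span_range_iff_exists_fun _).1 hwτ
    obtain ⟨k, hk⟩ : ∃ k, c k ≠ 0 := by
      by_contra! h
      exact hw (by simp [← hc, h])
    have hkpos : (0 : ℚ) < c k := lt_of_le_of_ne (c k).2 fun h => hk (Subtype.ext h.symm)
    -- A generator with positive coefficient in an element of a face lies in that face.
    have hmem : v k ∈ PointedCone.hull ℚ {w} := by
      refine hρ.mem_of_sum_smul_mem (f := v) (c := fun i => (c i : ℚ)) (fun i => ?_)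
        (fun i => (c i).2) ?_ k hkpos
      · rw [hτ]; exact Submodule.subset_span ⟨i, rfl⟩
      · have : ∑ i, (c i : ℚ) • v i = w := hc
        rw [this]
        exact Submodule.mem_span_singleton_self w
    refine ⟨k, le_antisymm ?_ ?_⟩
    · exact (Submodule.span_singleton_le_iff_mem _ _).2 hmem
    · refine (Submodule.span_singleton_le_iff_mem _ _).2 ?_
      obtain ⟨t, ht⟩ := Submodule.mem_span_singleton.1 hmem
      have ht0 : (t : ℚ) ≠ 0 := fun h => hv k (by rw [← ht, show t = 0 from Subtype.ext h, zero_smul])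
      refine Submodule.mem_span_singleton.2 ⟨⟨(t : ℚ)⁻¹, inv_nonneg.2 t.2⟩, ?_⟩
      have ht' : (t : ℚ) • w = v k := ht
      rw [← ht']
      exact inv_smul_smul₀ ht0 w
  · rintro ⟨k, rfl⟩
    exact ⟨hface k, v k, hv k, rfl⟩

theorem isExtremalRay_and_le_iff {N : Type*} [AddCommGroup N] [Module ℚ N]
    {σ τ ρ : PointedCone ℚ N} (hτ : τ.IsFaceOf σ) :
    IsExtremalRay ρ σ ∧ ρ ≤ τ ↔ IsExtremalRay ρ τ :=
  ⟨fun ⟨⟨h1, h2⟩, h3⟩ => ⟨(h1.isFaceOf_iff_le hτ).2 h3, h2⟩,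
    fun ⟨h1, h2⟩ => ⟨⟨h1.trans hτ, h2⟩, h1.le⟩⟩

/-! ### The cone over a square and the orthant. -/

/-- The cone over a square. -/
def squareCone : PointedCone ℚ (Fin 3 → ℚ) where
  carrier := {d | (∀ i, 0 ≤ d i) ∧ d 2 ≤ d 0 + d 1}
  zero_mem' := by simp
  add_mem' := fun ha hb => ⟨fun i => add_nonneg (ha.1 i) (hb.1 i), by
    have := ha.2; have := hb.2; simp only [Pi.add_apply]; linarith⟩
  smul_mem' := fun c d hd => ⟨fun i => mul_nonneg c.2 (hd.1 i), by
    have := mul_le_mul_of_nonneg_left hd.2 c.2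
    change (c : ℚ) * d 2 ≤ c * d 0 + c * d 1
    linarith⟩

/-- The vertices of the square. -/
def squareVertex : Fin 4 → Fin 3 → ℚ := ![![1, 0, 0], ![0, 1, 0], ![1, 0, 1], ![0, 1, 1]]

theorem squareVertex_mem (k : Fin 4) : squareVertex k ∈ squareCone := by
  refine ⟨fun i => ?_, ?_⟩
  · fin_cases k <;> fin_cases i <;> simp [squareVertex]
  · fin_cases k <;> simp [squareVertex]

theorem squareCone_eq_hull : squareCone = PointedCone.hull ℚ (Set.range squareVertex) := by
  refine le_antisymm (fun d hd => ?_) (Submodule.span_le.2 ?_)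
  · obtain ⟨h, hs⟩ := hd
    refine (Submodule.mem_span_range_iff_exists_fun _).2
      -- As much of `d 2` as possible is taken from `(1, 0, 1)`, the rest from `(0, 1, 1)`.
      ⟨![⟨d 0 - min (d 0) (d 2), by simp⟩,
        ⟨d 1 - (d 2 - min (d 0) (d 2)), ?_⟩, ⟨min (d 0) (d 2), le_min (h 0) (h 2)⟩,
        ⟨d 2 - min (d 0) (d 2), by simp⟩], ?_⟩
    · have := h 1
      rcases min_cases (d 0) (d 2) with h | h <;> linarith
    · rw [Fin.sum_univ_four]
      funext i
      simp only [Pi.add_apply]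
      fin_cases i <;> simp [squareVertex, Nonneg.mk_smul]
  · rintro _ ⟨k, rfl⟩
    exact squareVertex_mem k

theorem hull_squareVertex_isFaceOf (k : Fin 4) :
    (PointedCone.hull ℚ {squareVertex k}).IsFaceOf squareCone := by
  have key : ∀ x ∈ squareCone, x ∈ PointedCone.hull ℚ {squareVertex k} ↔
      ∃ t : ℚ, 0 ≤ t ∧ t • squareVertex k = x := fun x hx =>
    Submodule.mem_span_singleton.trans
      ⟨fun ⟨t, ht⟩ => ⟨t, t.2, ht⟩, fun ⟨t, h, ht⟩ => ⟨⟨t, h⟩, ht⟩⟩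
  refine PointedCone.IsFaceOf.of_mem_of_add_mem_left
    ((Submodule.span_singleton_le_iff_mem _ _).2 (squareVertex_mem k)) fun {x y} hx hy hxy => ?_
  obtain ⟨t, ht, h⟩ := (key _ (add_mem hx hy)).1 hxy
  rw [key x hx]
  have h0 := congrFun h 0
  have h1 := congrFun h 1
  have h2 := congrFun h 2
  obtain ⟨hx, hxs⟩ := hx
  obtain ⟨hy, hys⟩ := hy
  have := hx 0; have := hx 1; have := hx 2
  have := hy 0; have := hy 1; have := hy 2
  -- Two of the four defining inequalities are tight on the ray, so they are tight at both `x` and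
  -- `y`.
  fin_cases k <;> simp [squareVertex] at h0 h1 h2
  · refine ⟨x 0, hx 0, funext fun i => ?_⟩
    fin_cases i <;> simp [squareVertex] <;> linarith
  · refine ⟨x 1, hx 1, funext fun i => ?_⟩
    fin_cases i <;> simp [squareVertex] <;> linarith
  · refine ⟨x 0, hx 0, funext fun i => ?_⟩
    fin_cases i <;> simp [squareVertex] <;> linarith
  · refine ⟨x 1, hx 1, funext fun i => ?_⟩
    fin_cases i <;> simp [squareVertex] <;> linarith

theorem hull_squareVertex_injective :
    Function.Injective fun k => PointedCone.hull ℚ {squareVertex k} := by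
  intro k l h
  have hk : squareVertex k ∈ PointedCone.hull ℚ {squareVertex l} := by
    have h' : PointedCone.hull ℚ {squareVertex k} = PointedCone.hull ℚ {squareVertex l} := h
    rw [← h']
    exact Submodule.mem_span_singleton_self _
  obtain ⟨t, ht⟩ := Submodule.mem_span_singleton.1 hk
  have ht' : (t : ℚ) • squareVertex l = squareVertex k := ht
  have h0 := congrFun ht' 0
  have h1 := congrFun ht' 1
  have h2 := congrFun ht' 2
  fin_cases k <;> fin_cases l <;> simp [squareVertex] at h0 h1 h2 ⊢ <;> simp_all

theorem extremalRays_map_squareCone {N : Type*} [AddCommGroup N] [Module ℚ N]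
    {φ : (Fin 3 → ℚ) →ₗ[ℚ] N} (hφ : Function.Injective φ) :
    {ρ : PointedCone ℚ N | IsExtremalRay ρ (squareCone.map φ)}.ncard = 4 ∧
      sSup {ρ : PointedCone ℚ N | IsExtremalRay ρ (squareCone.map φ)} = squareCone.map φ := by
  have hhull : ∀ s : Set (Fin 3 → ℚ), (PointedCone.hull ℚ s).map φ = PointedCone.hull ℚ (φ '' s) :=
    fun s => Submodule.map_span _ s
  have hrange : squareCone.map φ =
      PointedCone.hull ℚ (Set.range fun k => φ (squareVertex k)) := by
    rw [squareCone_eq_hull, hhull, ← Set.range_comp]; rfl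
  have hray : ∀ k, PointedCone.hull ℚ {φ (squareVertex k)} =
      (PointedCone.hull ℚ {squareVertex k}).map φ := fun k => by
    rw [hhull, Set.image_singleton]
  rw [extremalRays_eq_range hrange]
  · constructor
    · rw [← Set.image_univ, Set.ncard_image_of_injective, Set.ncard_univ, Nat.card_fin]
      intro k l h
      simp only [hray] at h
      exact hull_squareVertex_injective (Submodule.map_injective_of_injective
        (f := φ.restrictScalars {c : ℚ // 0 ≤ c}) hφ h)
    · rw [sSup_range, hrange]
      exact (Submodule.span_range_eq_iSup).symm
  · intro k h
    have h' := hφ (h.trans (map_zero φ).symm)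
    have h0 := congrFun h' 0
    have h1 := congrFun h' 1
    fin_cases k <;> simp [squareVertex] at h0 h1
  · intro k
    rw [hray]
    exact (hull_squareVertex_isFaceOf k).map φ hφ

theorem isSimplicial_map_nonneg {N : Type*} [AddCommGroup N] [Module ℚ N]
    {φ : (Fin 3 → ℚ) →ₗ[ℚ] N} (hφ : Function.Injective φ) :
    ((PointedCone.positive ℚ (Fin 3 → ℚ)).map φ).IsSimplicial := by
  have hli : LinearIndependent ℚ fun i => φ (Pi.basisFun ℚ (Fin 3) i) :=
    (Pi.basisFun ℚ (Fin 3)).linearIndependent.map' φ (LinearMap.ker_eq_bot.2 hφ)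
  refine ⟨Set.range fun i => φ (Pi.basisFun ℚ (Fin 3) i), Set.finite_range _,
    hli.linearIndepOn_id, le_antisymm (Submodule.span_le.2 ?_) ?_⟩
  · rintro _ ⟨i, rfl⟩
    refine ⟨Pi.basisFun ℚ (Fin 3) i, ?_, rfl⟩
    simp [Pi.basisFun_apply, Pi.single_nonneg]
  · rintro _ ⟨d, hd, rfl⟩
    have hd : 0 ≤ d := hd
    refine (Submodule.mem_span_range_iff_exists_fun _).2 ⟨fun i => ⟨d i, hd i⟩, ?_⟩
    have : d = ∑ i, d i • Pi.basisFun ℚ (Fin 3) i := by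
      simpa using ((Pi.basisFun ℚ (Fin 3)).sum_repr d).symm
    conv_rhs => rw [this]
    simp [map_sum, Nonneg.mk_smul]

/-! ### Cones of connected relations on four labels. -/

/-- A cone in `ℚ^3` which is, up to an invertible linear map, the nonnegative orthant or the cone
over a square. -/
def IsOrthantOrSquare (C : PointedCone ℚ (Fin 3 → ℚ)) : Prop :=
  ∃ A : Matrix (Fin 3) (Fin 3) ℚ, IsUnit A.det ∧
    (C = (PointedCone.positive ℚ (Fin 3 → ℚ)).comap A.mulVecLin ∨
      C = squareCone.comap A.mulVecLin)

theorem isOrthantOrSquare_of_forall_mem_iff {C : PointedCone ℚ (Fin 3 → ℚ)}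
    (a b c : Fin 3 → ℚ) (hA : (Matrix.of ![a, b, c]).det ≠ 0)
    (h : ∀ d, d ∈ C ↔ 0 ≤ a ⬝ᵥ d ∧ 0 ≤ b ⬝ᵥ d ∧ 0 ≤ c ⬝ᵥ d) : IsOrthantOrSquare C := by
  refine ⟨_, hA.isUnit, Or.inl (SetLike.ext fun d => (h d).trans ?_)⟩
  change _ ↔ ∀ i, 0 ≤ (Matrix.of ![a, b, c]).mulVec d i
  simp [Fin.forall_fin_succ, Matrix.mulVec]

/-- Opposite facets of the square are given by `a`, `b` and by `c`, `a + b - c`. -/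
theorem isOrthantOrSquare_of_forall_mem_iff_four {C : PointedCone ℚ (Fin 3 → ℚ)}
    (a b c : Fin 3 → ℚ) (hA : (Matrix.of ![a, b, c]).det ≠ 0)
    (h : ∀ d, d ∈ C ↔ (0 ≤ a ⬝ᵥ d ∧ 0 ≤ b ⬝ᵥ d ∧ 0 ≤ c ⬝ᵥ d) ∧ c ⬝ᵥ d ≤ a ⬝ᵥ d + b ⬝ᵥ d) :
    IsOrthantOrSquare C := by
  refine ⟨_, hA.isUnit, Or.inr (SetLike.ext fun d => (h d).trans ?_)⟩
  change _ ↔ (∀ i, 0 ≤ (Matrix.of ![a, b, c]).mulVec d i) ∧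
    (Matrix.of ![a, b, c]).mulVec d 2 ≤
      (Matrix.of ![a, b, c]).mulVec d 0 + (Matrix.of ![a, b, c]).mulVec d 1
  simp [Fin.forall_fin_succ, Matrix.mulVec]

set_option maxHeartbeats 2000000 in
/-- A cone in `ℚ^3` given by inequalities `0 ≤ d b + ⋯ + d (a - 1)`, where the pairs `b < a` are
the edges of a connected graph on four vertices. -/
theorem isOrthantOrSquare_of_inequalities {C : PointedCone ℚ (Fin 3 → ℚ)}
    {p q r s t u : Prop}
    (hC : ∀ d, d ∈ C ↔ (p → 0 ≤ d 0) ∧ (q → 0 ≤ d 1) ∧ (r → 0 ≤ d 2) ∧ (s → 0 ≤ d 0 + d 1) ∧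
      (t → 0 ≤ d 1 + d 2) ∧ (u → 0 ≤ d 0 + d 1 + d 2))
    (h0 : p ∨ s ∨ u) (h1 : p ∨ q ∨ t) (h2 : q ∨ s ∨ r) (h3 : r ∨ t ∨ u)
    (h01 : q ∨ s ∨ t ∨ u) (h02 : p ∨ q ∨ r ∨ u) (h03 : p ∨ s ∨ r ∨ t) :
    IsOrthantOrSquare C := by
  have tree := @isOrthantOrSquare_of_forall_mem_iff C
  have square := @isOrthantOrSquare_of_forall_mem_iff_four C
  classical
  -- Each leaf lists the covering relations; the remaining inequalities are sums of these.
  refine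
    if hp : p then
      if hq : q then
        if hr : r then
          tree ![1, 0, 0] ![0, 1, 0] ![0, 0, 1] ?_ fun d => ?_
        else
          if ht : t then
            tree ![1, 0, 0] ![0, 1, 0] ![0, 1, 1] ?_ fun d => ?_
          else
            tree ![1, 0, 0] ![0, 1, 0] ![1, 1, 1] ?_ fun d => ?_
      else
        if hr : r then
          if hs : s then
            if ht : t then
              -- The diamond with `0` below `1` and `2`, and these below `3`; the fourth inequality
              -- is `0 ≤ d 2`.
              square ![1, 0, 0] ![0, 1, 1] ![1, 1, 0] ?_ fun d => ?_
            else
              tree ![1, 0, 0] ![0, 0, 1] ![1, 1, 0] ?_ fun d => ?_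
          else
            if ht : t then
              tree ![1, 0, 0] ![0, 0, 1] ![0, 1, 1] ?_ fun d => ?_
            else
              tree ![1, 0, 0] ![0, 0, 1] ![1, 1, 1] ?_ fun d => ?_
        else
          if ht : t then
            tree ![1, 0, 0] ![1, 1, 0] ![0, 1, 1] ?_ fun d => ?_
          else
            tree ![1, 0, 0] ![1, 1, 0] ![1, 1, 1] ?_ fun d => ?_
    else
      if hq : q then
        if hr : r then
          if hs : s then
            tree ![0, 1, 0] ![0, 0, 1] ![1, 1, 0] ?_ fun d => ?_
          else
            tree ![0, 1, 0] ![0, 0, 1] ![1, 1, 1] ?_ fun d => ?_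
        else
          if hs : s then
            if ht : t then
              if hu : u then
                -- Both `2` and `3` lie above both `0` and `1`; the fourth inequality is `0 ≤ d 0 +
                -- d 1 + d 2`.
                square ![1, 1, 0] ![0, 1, 1] ![0, 1, 0] ?_ fun d => ?_
              else
                tree ![0, 1, 0] ![1, 1, 0] ![0, 1, 1] ?_ fun d => ?_
            else
              tree ![0, 1, 0] ![1, 1, 0] ![1, 1, 1] ?_ fun d => ?_
          else
            if ht : t then
              tree ![0, 1, 0] ![0, 1, 1] ![1, 1, 1] ?_ fun d => ?_
            else
              -- Impossible by `h03`: nothing joins `{0, 3}` to `{1, 2}`.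
              ?_
      else
        if hr : r then
          if hs : s then
            tree ![0, 0, 1] ![0, 1, 1] ![1, 1, 0] ?_ fun d => ?_
          else
            tree ![0, 0, 1] ![0, 1, 1] ![1, 1, 1] ?_ fun d => ?_
        else
          tree ![1, 1, 0] ![0, 1, 1] ![1, 1, 1] ?_ fun d => ?_
  all_goals first
    | (simp [Matrix.det_fin_three]; done)
    | (simp only [hC, dotProduct, Fin.sum_univ_three, Matrix.cons_val]
       clear hC tree square
       grind)
    | (exfalso; tauto)

theorem map_comap_mulVecLin_eq {N : Type*} [AddCommGroup N] [Module ℚ N]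
    (φ : (Fin 3 → ℚ) →ₗ[ℚ] N) {A : Matrix (Fin 3) (Fin 3) ℚ} (hA : IsUnit A.det)
    (D : PointedCone ℚ (Fin 3 → ℚ)) :
    (D.comap A.mulVecLin).map φ = D.map (φ ∘ₗ A⁻¹.mulVecLin) := by
  ext x
  simp only [PointedCone.mem_map, PointedCone.mem_comap]
  constructor
  · rintro ⟨d, hd, rfl⟩
    exact ⟨_, hd, by simp [Matrix.mulVec_mulVec, Matrix.nonsing_inv_mul A hA]⟩
  · rintro ⟨d, hd, rfl⟩
    exact ⟨A⁻¹.mulVec d, by simpa [Matrix.mulVec_mulVec, Matrix.mul_nonsing_inv A hA] using hd, rfl⟩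

/-- A nonsimplicial cone which is the image of an orthant or of a cone over a square has four
extremal rays, which span it. -/
theorem extremalRays_of_isOrthantOrSquare {N : Type*} [AddCommGroup N] [Module ℚ N]
    {φ : (Fin 3 → ℚ) →ₗ[ℚ] N} (hφ : Function.Injective φ) {C : PointedCone ℚ (Fin 3 → ℚ)}
    (hC : IsOrthantOrSquare C) (hns : ¬ (C.map φ).IsSimplicial) :
    {ρ : PointedCone ℚ N | IsExtremalRay ρ (C.map φ)}.ncard = 4 ∧
      sSup {ρ : PointedCone ℚ N | IsExtremalRay ρ (C.map φ)} = C.map φ := by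
  obtain ⟨A, hA, h⟩ := hC
  have hinj : Function.Injective (φ ∘ₗ A⁻¹.mulVecLin) :=
    hφ.comp (Matrix.mulVec_injective_of_isUnit
      ((Matrix.isUnit_nonsing_inv_iff).2 ((Matrix.isUnit_iff_isUnit_det A).2 hA)))
  rcases h with rfl | rfl <;> rw [map_comap_mulVecLin_eq φ hA] at hns ⊢
  · exact absurd (isSimplicial_map_nonneg hinj) hns
  · exact extremalRays_map_squareCone hinj

/-- The function on `Fin 4` vanishing at `0` with given successive differences. -/
def partialSums : (Fin 3 → ℚ) →ₗ[ℚ] (Fin 4 → ℚ) where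
  toFun d := ![0, d 0, d 0 + d 1, d 0 + d 1 + d 2]
  map_add' d d' := by
    funext i; fin_cases i <;> simp <;> ring
  map_smul' c d := by
    funext i; fin_cases i <;> simp <;> ring

theorem isOrthantOrSquare_comap_partialSums {R : Fin 4 → Fin 4 → Prop}
    (hlt : ∀ a b, R a b → a ≠ b → b < a)
    (hconn : ∀ S : Set (Fin 4), S.Nonempty → Sᶜ.Nonempty → ∃ a b, R a b ∧ ¬ (a ∈ S ↔ b ∈ S)) :
    IsOrthantOrSquare ((monotoneCone R).comap partialSums) := by
  have cut : ∀ (S : Finset (Fin 4)) {P : Prop}, S.Nonempty → Sᶜ.Nonempty →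
      (∀ a b, R a b → b < a → ¬ (a ∈ S ↔ b ∈ S) → P) → P := fun S P h1 h2 h => by
    obtain ⟨a, b, hR, hS⟩ := hconn S h1 (by rwa [← Finset.coe_compl, Finset.coe_nonempty])
    refine h a b hR (hlt a b hR ?_) (by simpa using hS)
    rintro rfl
    exact hS Iff.rfl
  -- The seven sets represent all partitions of four labels into two nonempty parts.
  refine isOrthantOrSquare_of_inequalities (p := R 1 0) (q := R 2 1) (r := R 3 2) (s := R 2 0)
    (t := R 3 1) (u := R 3 0) (fun d => ?_) (cut {0} (by decide) (by decide) ?_)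
    (cut {1} (by decide) (by decide) ?_) (cut {2} (by decide) (by decide) ?_)
    (cut {3} (by decide) (by decide) ?_) (cut {0, 1} (by decide) (by decide) ?_)
    (cut {0, 2} (by decide) (by decide) ?_) (cut {0, 3} (by decide) (by decide) ?_)
  · rw [PointedCone.mem_comap, mem_monotoneCone]
    constructor
    · intro h
      refine ⟨fun hR => ?_, fun hR => ?_, fun hR => ?_, fun hR => ?_, fun hR => ?_, fun hR => ?_⟩ <;>
        have := h _ _ hR <;> simp [partialSums] at this <;> linarith
    · rintro ⟨h1, h2, h3, h4, h5, h6⟩ a b hR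
      have hlt := hlt a b hR
      fin_cases a <;> fin_cases b <;> simp [partialSums] at hR hlt h1 h2 h3 h4 h5 h6 ⊢ <;>
        simp only [hR, true_implies] at h1 h2 h3 h4 h5 h6 <;> linarith
  all_goals
    clear cut hconn hlt
    intro a b hR hba hS
    fin_cases a <;> fin_cases b <;> simp_all

/-! ### Three-dimensional faces modulo constants. -/

/-- If `π` identifies functions differing by a constant, then functions on the classes of a
labelling with `k` labels have an image of dimension `k - 1`. -/
theorem finrank_range_comp_funLeft {V N : Type*} [AddCommGroup N] [Module ℚ N] {k : ℕ}
    {g : V → Fin k} (hg : Function.Surjective g) (hk : k ≠ 0) {π : (V → ℚ) →ₗ[ℚ] N}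
    (hker : ∀ y, π y = 0 ↔ ∃ c, y = fun _ => c) :
    Module.finrank ℚ (LinearMap.range (π ∘ₗ LinearMap.funLeft ℚ ℚ g)) + 1 = k := by
  have h := (π ∘ₗ LinearMap.funLeft ℚ ℚ g).finrank_range_add_finrank_ker
  have hkereq : LinearMap.ker (π ∘ₗ LinearMap.funLeft ℚ ℚ g) =
      Submodule.span ℚ {fun _ : Fin k => (1 : ℚ)} := by
    ext w
    rw [LinearMap.mem_ker, LinearMap.comp_apply, hker, Submodule.mem_span_singleton]
    constructor
    · rintro ⟨c, hc⟩
      refine ⟨c, funext fun i => ?_⟩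
      obtain ⟨v, rfl⟩ := hg i
      simpa [LinearMap.funLeft_apply] using (congrFun hc v).symm
    · rintro ⟨c, rfl⟩
      exact ⟨c, by funext v; simp [LinearMap.funLeft_apply]⟩
  have hne : (fun _ : Fin k => (1 : ℚ)) ≠ 0 := fun h0 =>
    one_ne_zero (congrFun h0 ⟨0, Nat.pos_of_ne_zero hk⟩)
  rw [hkereq, finrank_span_singleton hne, Module.finrank_fin_fun] at h
  exact h

/-- The nonsimplicial three-dimensional faces of the cone of monotone functions modulo constants of
a connected relation. -/
theorem extremalRays_of_face_of_monotoneCone {V N : Type*} [Fintype V] [AddCommGroup N] [Module ℚ N]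
    {E : V → V → Prop} (hconn : ∀ S : Set V, (∀ u v, E u v → (u ∈ S ↔ v ∈ S)) → ∀ u v, u ∈ S → v ∈ S)
    {π : (V → ℚ) →ₗ[ℚ] N} (hπ : Function.Surjective π)
    (hker : ∀ y, π y = 0 ↔ ∃ c, y = fun _ => c) {σ τ : PointedCone ℚ N}
    (hσ : σ.comap π = monotoneCone E) (hface : τ.IsFaceOf σ) (hdim : coneDim τ = 3)
    (hns : ¬ τ.IsSimplicial) :
    {ρ : PointedCone ℚ N | IsExtremalRay ρ σ ∧ ρ ≤ τ}.ncard = 4 ∧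
      sSup {ρ : PointedCone ℚ N | IsExtremalRay ρ σ ∧ ρ ≤ τ} = τ := by
  simp only [isExtremalRay_and_le_iff hface]
  have hF : (τ.comap π).IsFaceOf (monotoneCone E) := hσ ▸ hface.comap π
  obtain ⟨k, g, hg, hlt, hmem, hspan⟩ := exists_labelling_of_face hF
  have himage : (τ : Set N) = π '' (τ.comap π : Set (V → ℚ)) :=
    (Set.image_preimage_eq _ hπ).symm
  have hspanτ : Submodule.span ℚ (τ : Set N) =
      LinearMap.range (π ∘ₗ LinearMap.funLeft ℚ ℚ g) := by
    rw [himage, ← Submodule.map_span, hspan, LinearMap.range_comp]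
  obtain rfl : k = 4 := by
    rw [coneDim, hspanτ] at hdim
    have hk : k ≠ 0 := by
      rintro rfl
      have := LinearMap.finrank_range_le (π ∘ₗ LinearMap.funLeft ℚ ℚ g)
      rw [hdim, Module.finrank_fin_fun] at this
      omega
    have := finrank_range_comp_funLeft hg hk hker
    omega
  let φ : (Fin 3 → ℚ) →ₗ[ℚ] N := π ∘ₗ LinearMap.funLeft ℚ ℚ g ∘ₗ partialSums
  have hφ : Function.Injective φ := by
    refine (injective_iff_map_eq_zero φ).2 fun d hd => ?_
    obtain ⟨c, hc⟩ := (hker _).1 hd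
    have hval : ∀ i, partialSums d i = c := fun i => by
      obtain ⟨v, rfl⟩ := hg i
      exact congrFun hc v
    have h0 := hval 0
    have h1 := hval 1
    have h2 := hval 2
    have h3 := hval 3
    simp [partialSums] at h0 h1 h2 h3
    funext i
    fin_cases i <;> simp <;> linarith
  let R : Fin 4 → Fin 4 → Prop := fun a b => ∃ u v, E u v ∧ g u = a ∧ g v = b
  have hτ : τ = ((monotoneCone R).comap partialSums).map φ := by
    have hmono : ∀ w : Fin 4 → ℚ, w ∈ monotoneCone R ↔ ∀ u v, E u v → w (g v) ≤ w (g u) :=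
      fun w => ⟨fun h u v hE => h _ _ ⟨u, v, hE, rfl, rfl⟩, by
        rintro h _ _ ⟨u, v, hE, rfl, rfl⟩
        exact h u v hE⟩
    ext x
    rw [PointedCone.mem_map]
    constructor
    · intro hx
      obtain ⟨y, rfl⟩ := hπ x
      obtain ⟨w, rfl, hw⟩ := (hmem y).1 hx
      have hsum : ∀ i, partialSums ![w 1 - w 0, w 2 - w 1, w 3 - w 2] i = w i - w 0 := by
        intro i
        fin_cases i <;> simp [partialSums]
      refine ⟨![w 1 - w 0, w 2 - w 1, w 3 - w 2], ?_, ?_⟩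
      · rw [PointedCone.mem_comap, hmono]
        intro u v hE
        rw [hsum, hsum]
        exact sub_le_sub_right (hw u v hE) _
      · rw [← sub_eq_zero]
        change π _ - π _ = 0
        rw [← map_sub, hker]
        refine ⟨-w 0, funext fun v => ?_⟩
        simp [LinearMap.funLeft_apply, hsum]
    · rintro ⟨d, hd, rfl⟩
      rw [PointedCone.mem_comap, hmono] at hd
      exact (hmem _).2 ⟨partialSums d, rfl, hd⟩
  rw [hτ] at hns ⊢
  refine extremalRays_of_isOrthantOrSquare hφ (isOrthantOrSquare_comap_partialSums ?_ ?_) hns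
  · rintro _ _ ⟨u, v, hE, rfl, rfl⟩ hne
    exact hlt u v hE hne
  · rintro S ⟨a, ha⟩ ⟨b, hb⟩
    by_contra! h
    obtain ⟨u, rfl⟩ := hg a
    obtain ⟨v, rfl⟩ := hg b
    exact hb (hconn (g ⁻¹' S) (fun u v hE => h _ _ ⟨u, v, hE, rfl, rfl⟩) u v ha)

/-! ### The edge cone as a cone of monotone functions. -/

theorem oneNegOne_mul_self (m n : ℕ) : oneNegOne m n * oneNegOne m n = 1 := by
  funext v
  rcases v with i | j <;> simp [oneNegOne]

/-- The class in `N_ℚ` of a function on the vertices, with the signs changed on the second side. -/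
def ofPotential (m n : ℕ) : (Fin m ⊕ Fin n → ℚ) →ₗ[ℚ] NQ m n :=
  (Submodule.span ℚ {oneNegOne m n}).mkQ ∘ₗ LinearMap.mulLeft ℚ (oneNegOne m n)

theorem ofPotential_surjective (m n : ℕ) : Function.Surjective (ofPotential m n) := by
  intro x
  obtain ⟨y, rfl⟩ := Submodule.mkQ_surjective _ x
  refine ⟨oneNegOne m n * y, ?_⟩
  simp [ofPotential, ← mul_assoc, oneNegOne_mul_self]

theorem ofPotential_eq_zero_iff {m n : ℕ} (y : Fin m ⊕ Fin n → ℚ) :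
    ofPotential m n y = 0 ↔ ∃ c, y = fun _ => c := by
  rw [ofPotential, LinearMap.comp_apply, Submodule.mkQ_apply, Submodule.Quotient.mk_eq_zero,
    Submodule.mem_span_singleton, LinearMap.mulLeft_apply]
  refine exists_congr fun c => ⟨fun h => ?_, ?_⟩
  · have := congrArg (oneNegOne m n * ·) h
    simp only [mul_smul_comm, ← mul_assoc, oneNegOne_mul_self, one_mul] at this
    rw [← this]
    funext v
    simp
  · rintro rfl
    funext v
    simp [mul_comm]

/-- The sign change turns the sum over an edge into a difference, so nonnegativity becomes
monotonicity. -/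
theorem pairingMN_edgeVector_ofPotential {m n : ℕ} (i : Fin m) (j : Fin n)
    (y : Fin m ⊕ Fin n → ℚ) :
    pairingMN m n (edgeVector m n i j) (ofPotential m n y) = y (Sum.inl i) - y (Sum.inr j) := by
  change (oneNegOne m n * y) ⬝ᵥ (Pi.single (Sum.inl i) 1 + Pi.single (Sum.inr j) 1) = _
  simp [oneNegOne, sub_eq_add_neg]

theorem comap_ofPotential_edgeCone {m n : ℕ} (G : SimpleGraph (Fin m ⊕ Fin n)) :
    (edgeCone G).comap (ofPotential m n) = monotoneCone fun u v =>
      ∃ (i : Fin m) (j : Fin n), G.Adj (Sum.inl i) (Sum.inr j) ∧ u = Sum.inl i ∧ v = Sum.inr j := by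
  ext y
  rw [PointedCone.mem_comap, edgeCone, dualEdgeCone, PointedCone.dual_hull, PointedCone.mem_dual,
    mem_monotoneCone]
  constructor
  · rintro h _ _ ⟨i, j, hadj, rfl, rfl⟩
    have := h ⟨i, j, hadj, rfl⟩
    rw [pairingMN_edgeVector_ofPotential] at this
    exact sub_nonneg.1 this
  · rintro h _ ⟨i, j, hadj, rfl⟩
    rw [pairingMN_edgeVector_ofPotential]
    exact sub_nonneg.2 (h _ _ ⟨i, j, hadj, rfl, rfl⟩)

theorem mainTheorem7 (m n : ℕ) (G : SimpleGraph (Fin m ⊕ Fin n))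
    (hG : G ≤ completeBipartiteGraph (Fin m) (Fin n)) (hconn : G.Connected)
    (τ : PointedCone ℚ (NQ m n)) (hface : τ.IsFaceOf (edgeCone G))
    (hdim : coneDim τ = 3) (hns : ¬ τ.IsSimplicial) :
    {ρ : PointedCone ℚ (NQ m n) | IsExtremalRay ρ (edgeCone G) ∧ ρ ≤ τ}.ncard = 4 ∧
      sSup {ρ : PointedCone ℚ (NQ m n) | IsExtremalRay ρ (edgeCone G) ∧ ρ ≤ τ} = τ := by
  refine extremalRays_of_face_of_monotoneCone (fun S hS u v hu => ?_) (ofPotential_surjective m n)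
    ofPotential_eq_zero_iff (comap_ofPotential_edgeCone G) hface hdim hns
  have hadj : ∀ u v, G.Adj u v → (u ∈ S ↔ v ∈ S) := by
    rintro (i | i) (j | j) h
    · simpa using hG h
    · exact hS _ _ ⟨i, j, h, rfl, rfl⟩
    · exact (hS _ _ ⟨j, i, h.symm, rfl, rfl⟩).symm
    · simpa using hG h
  obtain ⟨p⟩ := hconn.preconnected u v
  induction p with
  | nil => exact hu
  | cons h _ ih => exact ih ((hadj _ _ h).1 hu)
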